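/- Let $n,p\ge 1$ and $d$ be integers, and let $X_{i,j}$ ($1\le i\le n$, $1\le j\le d$) be independent real-valued random variables with $\mathbb{E}|X_{i,j}|^{p+1}<\infty$. Let $Z$ be a standard normal random variable and $\mathbf{Z}$ a standard $d$-dimensional normal random vector. For non-negative integers $k\le p$ put $\epsilon_{i,j,k}=\mathbb{E}X_{i,j}^k-\mathbb{E}Z^k$; let $\mathbf{X}_i=(X_{i,1},\ldots,X_{i,d})^T$ and $\mathbf{W}_n=\frac{1}{\sqrt n}\sum_{i=1}^n\mathbf{X}_i$. Let $C_b^{p+1}(\mathbb{R}^d)$ be the space of bounded functions $h:\mathbb{R}^d\to\mathbb{R}$ that are $p+1$ times differentiable with bounded derivatives of all orders $k\le p+1$, and write $\|g\|=\sup_{\mathbf{w}\in\mathbb{R}^d}|g(\mathbf{w})|$. Then, for all $h\in C_b^{p+1}(\mathbb{R}^d)$, \begin{align*}|\mathbb{E}h(\mathbf{W}_n)-\mathbb{E}h(\mathbf{Z})|&\leq \sum_{i=1}^{n}\sum_{j=1}^d\frac{|\epsilon_{i,j,1}|}{\sqrt{n}}\bigg\|\frac{\partial h}{\partial w_j}\bigg\|+\sum_{i=1}^{n}\sum_{j=1}^d\sum_{k=1}^{p-1}\frac{M_{j,k}}{k!\,n^{(k+1)/2}}\,|k\epsilon_{i,j,k-1}-\epsilon_{i,j,k+1}|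 \\ &\quad +\sum_{i=1}^{n}\sum_{j=1}^d\frac{M_{j,p}}{n^{(p+1)/2}}\bigg(\frac{\mathbb{E}|X_{i,j}|^{p-1}}{(p-1)!}+\frac{\mathbb{E}|X_{i,j}|^{p+1}}{p!}\bigg),\end{align*} where, for $1\le j\le d$ and $1\le k\le p$, \[M_{j,k}=\min\bigg\{\frac{\Gamma(\frac{k+1}{2})}{\sqrt{2}\,\Gamma(\frac{k}{2}+1)}\bigg\|\frac{\partial^{k}h}{\partial w_j^k}\bigg\|,\ \frac{1}{k+1}\bigg\|\frac{\partial^{k+1}h}{\partial w_j^{k+1}}\bigg\|\bigg\}.\] -/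

import Mathlib

open MeasureTheory ProbabilityTheory

noncomputable section

namespace MatchingMoments

/-- `h ∈ C_b^m(ℝ^d)`: `h` is `m` times differentiable, and `h` together with its derivatives
`D^k h`, `1 ≤ k ≤ m`, is bounded (the case `k = 0` of `bounded` is the boundedness of `h`).
Continuity of the top derivative `D^m h` is not required. -/
structure IsCb {d : ℕ} (m : ℕ) (h : EuclideanSpace ℝ (Fin d) → ℝ) : Prop where
  differentiable : ∀ k < m, Differentiable ℝ (iteratedFDeriv ℝ k h)
  bounded : ∀ k ≤ m, ∃ C : ℝ, ∀ w, ‖iteratedFDeriv ℝ k h w‖ ≤ C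

/-- The partial derivative `∂g/∂w_j`. -/
def partialDeriv {d : ℕ} (j : Fin d) (g : EuclideanSpace ℝ (Fin d) → ℝ) :
    EuclideanSpace ℝ (Fin d) → ℝ :=
  fun w => lineDeriv ℝ g w (EuclideanSpace.single j (1 : ℝ))

/-- The iterated partial derivative `∂^k g/∂w_j^k`. -/
def iterPartialDeriv {d : ℕ} (j : Fin d) (k : ℕ) (g : EuclideanSpace ℝ (Fin d) → ℝ) :
    EuclideanSpace ℝ (Fin d) → ℝ :=
  (partialDeriv j)^[k] g

/-- The supremum norm `‖g‖ = sup_w |g(w)|` (of a bounded function). -/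
def supNorm {d : ℕ} (g : EuclideanSpace ℝ (Fin d) → ℝ) : ℝ :=
  ⨆ w, |g w|

/-- The constant `M_{j,k}` attached to the test function `h`. -/
def M {d : ℕ} (h : EuclideanSpace ℝ (Fin d) → ℝ) (j : Fin d) (k : ℕ) : ℝ :=
  min
    (Real.Gamma (((k : ℝ) + 1) / 2) / (Real.sqrt 2 * Real.Gamma ((k : ℝ) / 2 + 1))
      * supNorm (iterPartialDeriv j k h))
    (1 / ((k : ℝ) + 1) * supNorm (iterPartialDeriv j (k + 1) h))

/-- The moment mismatch `E Y^k - E Z^k`, with `Z` standard normal. -/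
def momentMismatch {Ω : Type*} [MeasurableSpace Ω] (P : Measure Ω) (Y : Ω → ℝ) (k : ℕ) : ℝ :=
  (∫ ω, (Y ω) ^ k ∂P) - ∫ z, z ^ k ∂(gaussianReal 0 1)

/-- The standardised sum `W_n = n^{-1/2} ∑_i X_i`, where `X_i = (X_{i,1}, …, X_{i,d})ᵀ`. -/
def standardisedSum {Ω : Type*} {n d : ℕ} (X : Fin n → Fin d → Ω → ℝ) (ω : Ω) :
    EuclideanSpace ℝ (Fin d) :=
  (1 / Real.sqrt n) • ∑ i, WithLp.toLp 2 (fun j => X i j ω)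

end MatchingMoments

end

/-!
The proof is Stein's method. Let `P_θ g (w) = E g(sin θ w + cos θ Z)`. Integrating the derivative
of `P_θ h (w)` over `0 ≤ θ ≤ π / 2` and integrating by parts against the Gaussian density gives
the Stein equation `h(w) - E h(Z) = ∑ j, (w_j f_j(w) - ∂f_j/∂w_j (w))`, where
`∂^k f_j/∂w_j^k = ∫ cos θ (sin θ)^k P_θ (∂^(k+1) h/∂w_j^(k+1)) dθ`. Bounding the integrand directly
gives the second term of the minimum `M_{j,k}`; moving one derivative onto the Gaussian density
first gives the other.

At `w = W_n` the right-hand side is a sum over `(i, j)` of `X_{i,j} f_j(W_n) / √n` minus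
`∂f_j/∂w_j (W_n) / n`. Write `W_n = Y + X_{i,j} e_j / √n` with `Y` independent of `X_{i,j}`, and
expand both terms in Taylor series in `X_{i,j} / √n`. The coefficient of the `k`-th derivative of
`f_j` is a multiple of `k E X^(k-1) - E X^(k+1)`, which the recursion `E Z^(k+1) = k E Z^(k-1)`
turns into the difference of moment mismatches.
-/

noncomputable section

namespace MatchingMoments

section GaussianMoments

variable {μ : ℝ} {v : NNReal}

lemma integrable_gaussianReal_iff (hv : v ≠ 0) {f : ℝ → ℝ} :
    Integrable f (gaussianReal μ v) ↔ Integrable (fun x => f x * gaussianPDFReal μ v x) := by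
  rw [gaussianReal_of_var_ne_zero μ hv,
    integrable_withDensity_iff_integrable_smul' (measurable_gaussianPDF μ v)
      (Filter.Eventually.of_forall fun _ => gaussianPDF_lt_top)]
  simp [toReal_gaussianPDF, mul_comm]

lemma integral_gaussianReal_eq_integral_mul (hv : v ≠ 0) (f : ℝ → ℝ) :
    ∫ x, f x ∂(gaussianReal μ v) = ∫ x, f x * gaussianPDFReal μ v x := by
  rw [integral_gaussianReal_eq_integral_smul hv]
  simp [mul_comm]

lemma hasDerivAt_gaussianPDFReal (μ : ℝ) (v : NNReal) (x : ℝ) :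
    HasDerivAt (gaussianPDFReal μ v) (-((x - μ) / v * gaussianPDFReal μ v x)) x := by
  have hexponent : HasDerivAt (fun x : ℝ => -(x - μ) ^ 2 / (2 * (v : ℝ)))
      (-((x - μ) / v)) x :=
    ((((hasDerivAt_id x).sub_const μ).pow 2).neg.div_const (2 * (v : ℝ))).congr_deriv
      (by simp [neg_div, mul_div_mul_left])
  rw [gaussianPDFReal_def]
  exact (hexponent.exp.const_mul (√(2 * Real.pi * (v : ℝ)))⁻¹).congr_deriv (by ring)

lemma integral_sub_mul_gaussianReal {u u' : ℝ → ℝ} (hu : ∀ x, HasDerivAt u (u' x) x)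
    (hu_int : Integrable u (gaussianReal μ v)) (hu'_int : Integrable u' (gaussianReal μ v))
    (hxu_int : Integrable (fun x => (x - μ) * u x) (gaussianReal μ v)) :
    ∫ x, (x - μ) * u x ∂(gaussianReal μ v) = v * ∫ x, u' x ∂(gaussianReal μ v) := by
  obtain rfl | hv := eq_or_ne v 0
  · simp
  rw [integrable_gaussianReal_iff hv] at hu_int hu'_int hxu_int
  rw [integral_gaussianReal_eq_integral_mul hv, integral_gaussianReal_eq_integral_mul hv]
  have hv' : (v : ℝ) ≠ 0 := by exact_mod_cast hv
  have parts := integral_mul_deriv_eq_deriv_mul_of_integrable (u := u) (u' := u')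
    (v := gaussianPDFReal μ v) (v' := fun x => -((x - μ) / v * gaussianPDFReal μ v x))
    (fun x _ => hu x) (fun x _ => hasDerivAt_gaussianPDFReal μ v x)
    ((hxu_int.const_mul (-(v : ℝ)⁻¹)).congr
      (.of_forall fun x => by simp only [Pi.mul_apply]; ring)) hu'_int hu_int
  rw [← neg_inj, ← mul_neg, ← parts, ← integral_neg, ← integral_const_mul]
  congr 1 with x
  field_simp

lemma integrable_pow_gaussianReal (k : ℕ) : Integrable (fun x => x ^ k) (gaussianReal μ v) := by
  refine (integrable_norm_iff (by fun_prop)).1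
    ((memLp_id_gaussianReal (μ := μ) (v := v) k).integrable_norm_pow'.congr ?_)
  simp

lemma integral_pow_add_two_gaussianReal (k : ℕ) :
    ∫ x, x ^ (k + 2) ∂(gaussianReal 0 v) = v * (k + 1) * ∫ x, x ^ k ∂(gaussianReal 0 v) := by
  have parts := integral_sub_mul_gaussianReal (μ := 0) (v := v) (u := fun x => x ^ (k + 1))
    (u' := fun x => (k + 1 : ℝ) * x ^ k) (fun x => by simpa using hasDerivAt_pow (k + 1) x)
    (integrable_pow_gaussianReal _) ((integrable_pow_gaussianReal _).const_mul _)
    ((integrable_pow_gaussianReal (k + 2)).congr (.of_forall fun x => by ring))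
  rw [mul_assoc, ← integral_const_mul, ← parts]
  congr 1 with x
  ring

lemma integral_abs_gaussianReal : ∫ x, |x| ∂(gaussianReal 0 v) = √(2 * v / Real.pi) := by
  obtain rfl | hv := eq_or_ne v 0
  · simp
  have : 0 < (v : ℝ) := by exact_mod_cast pos_iff_ne_zero.2 hv
  have density (x : ℝ) : |x| * gaussianPDFReal 0 v x
      = (√(2 * Real.pi * v))⁻¹ * (|x| * Real.exp (-(1 / (2 * v)) * |x| ^ 2)) := by
    simp only [gaussianPDFReal_def, sub_zero, sq_abs]
    ring_nf
  have half_line : ∫ x in Set.Ioi (0 : ℝ), x * Real.exp (-(1 / (2 * v)) * x ^ 2) = v := by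
    have h := integral_rpow_mul_exp_neg_mul_rpow (p := 2) (q := 1) (b := 1 / (2 * (v : ℝ)))
      (by norm_num) (by norm_num) (by positivity)
    simp only [Real.rpow_one, Real.rpow_two] at h
    rw [h]
    norm_num [Real.rpow_neg_one]
    ring
  rw [integral_gaussianReal_eq_integral_mul hv]
  simp only [density]
  rw [integral_const_mul, integral_comp_abs (f := fun y => y * Real.exp (-(1 / (2 * v)) * y ^ 2)),
    half_line, eq_comm, Real.sqrt_eq_iff_mul_self_eq (by positivity) (by positivity),
    mul_mul_mul_comm, ← mul_inv, Real.mul_self_sqrt (by positivity)]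
  field_simp

end GaussianMoments

section TrigonometricIntegrals

lemma integral_sin_pow_pi_div_two (k : ℕ) :
    ∫ x in (0 : ℝ)..(Real.pi / 2), Real.sin x ^ k
      = √Real.pi / 2 * (Real.Gamma (((k : ℝ) + 1) / 2) / Real.Gamma ((k : ℝ) / 2 + 1)) := by
  have hpi : √Real.pi * √Real.pi = Real.pi := Real.mul_self_sqrt Real.pi_pos.le
  have hpi0 : √Real.pi ≠ 0 := by positivity
  induction k using Nat.twoStepInduction with
  | zero =>
    simp only [pow_zero, Nat.cast_zero, zero_add, zero_div, Real.Gamma_one,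
      Real.Gamma_one_half_eq, intervalIntegral.integral_const, smul_eq_mul]
    linarith
  | one =>
    have hGamma : Real.Gamma (1 / 2 + 1) = 1 / 2 * √Real.pi := by
      rw [Real.Gamma_add_one (by norm_num), Real.Gamma_one_half_eq]
    simp only [pow_one, integral_sin, Nat.cast_one, hGamma]
    norm_num
    field_simp
  | more k ih _ =>
    have hnum : (((k + 2 : ℕ) : ℝ) + 1) / 2 = ((k : ℝ) + 1) / 2 + 1 := by push_cast; ring
    have hden : ((k + 2 : ℕ) : ℝ) / 2 + 1 = ((k : ℝ) / 2 + 1) + 1 := by push_cast; ring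
    have : Real.Gamma ((k : ℝ) / 2 + 1) ≠ 0 := (Real.Gamma_pos_of_pos (by positivity)).ne'
    rw [integral_sin_pow, ih, hnum, hden,
      Real.Gamma_add_one (s := ((k : ℝ) + 1) / 2) (by positivity),
      Real.Gamma_add_one (s := (k : ℝ) / 2 + 1) (by positivity), Real.cos_zero,
      Real.cos_pi_div_two, Real.sin_zero]
    field_simp
    simp

lemma sqrt_two_div_pi_mul_integral_sin_pow (k : ℕ) :
    √(2 / Real.pi) * ∫ x in (0 : ℝ)..(Real.pi / 2), Real.sin x ^ k
      = Real.Gamma (((k : ℝ) + 1) / 2) / (√2 * Real.Gamma ((k : ℝ) / 2 + 1)) := by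
  rw [integral_sin_pow_pi_div_two, Real.sqrt_div (by norm_num)]
  have hpi0 : √Real.pi ≠ 0 := by positivity
  have : Real.Gamma ((k : ℝ) / 2 + 1) ≠ 0 := (Real.Gamma_pos_of_pos (by positivity)).ne'
  field_simp
  norm_num

lemma integral_cos_mul_sin_pow (k : ℕ) :
    ∫ x in (0 : ℝ)..(Real.pi / 2), Real.cos x * Real.sin x ^ k = 1 / ((k : ℝ) + 1) := by
  have h := integral_sin_pow_mul_cos_pow_odd (a := 0) (b := Real.pi / 2) k 0
  simpa [mul_comm] using h

end TrigonometricIntegrals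

section Taylor

lemma eqOn_iteratedDerivWithin {𝕜 F : Type*} [NontriviallyNormedField 𝕜] [NormedAddCommGroup F]
    [NormedSpace 𝕜 F] {m : ℕ} {G : ℕ → 𝕜 → F} {s : Set 𝕜} (hs : UniqueDiffOn 𝕜 s)
    (hG : ∀ k < m, ∀ t, HasDerivAt (G k) (G (k + 1) t) t) {k : ℕ} (hk : k ≤ m) :
    Set.EqOn (iteratedDerivWithin k (G 0) s) (G k) s := by
  induction k with
  | zero => exact fun t _ => by rw [iteratedDerivWithin_zero]
  | succ k ih =>
    intro t ht
    have ih := ih (by omega)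
    rw [iteratedDerivWithin_succ, derivWithin_congr ih (ih ht)]
    exact (hG k (by omega) t).hasDerivWithinAt.derivWithin (hs t ht)

variable {m : ℕ} {G : ℕ → ℝ → ℝ}

lemma abs_sub_taylor_le {C : ℝ} (hG : ∀ k < m, ∀ t, HasDerivAt (G k) (G (k + 1) t) t)
    (hC : ∀ t, |G m t| ≤ C) (t : ℝ) :
    |G 0 t - ∑ k ∈ Finset.range m, G k 0 * t ^ k / (k.factorial : ℝ)|
      ≤ C * |t| ^ m / (m.factorial : ℝ) := by
  obtain _ | m := m
  · simpa using hC t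
  obtain rfl | ht := eq_or_ne 0 t
  · simp [Finset.sum_range_succ']
  have hderiv {k : ℕ} (hk : k ≤ m + 1) := eqOn_iteratedDerivWithin (uniqueDiffOn_uIcc ht) hG hk
  have hdiff (k : ℕ) (hk : k ≤ m) :
      DifferentiableOn ℝ (iteratedDerivWithin k (G 0) (Set.uIcc 0 t)) (Set.uIcc 0 t) :=
    DifferentiableOn.congr
      (fun s _ => (hG k (by omega) s).differentiableAt.differentiableWithinAt) (hderiv (by omega))
  have hcont : ContDiffOn ℝ m (G 0) (Set.uIcc 0 t) :=
    contDiffOn_of_continuousOn_differentiableOn_deriv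
      (fun k hk => (hdiff k (by exact_mod_cast hk)).continuousOn)
      (fun k hk => hdiff k (by exact_mod_cast hk.le))
  obtain ⟨s, hs, hremainder⟩ := taylor_mean_remainder_lagrange ht hcont
    ((hdiff m le_rfl).mono Set.uIoo_subset_uIcc_self)
  rw [hderiv le_rfl (Set.uIoo_subset_uIcc_self hs), taylor_within_apply, sub_zero] at hremainder
  have htaylor : ∑ k ∈ Finset.range (m + 1), G k 0 * t ^ k / (k.factorial : ℝ)
      = ∑ k ∈ Finset.range (m + 1),
        ((k.factorial : ℝ)⁻¹ * t ^ k) • iteratedDerivWithin k (G 0) (Set.uIcc 0 t) 0 := by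
    refine Finset.sum_congr rfl fun k hk => ?_
    rw [hderiv (Finset.mem_range.1 hk).le Set.left_mem_uIcc, smul_eq_mul]
    ring
  rw [htaylor, hremainder, abs_div, abs_mul, abs_pow, Nat.abs_cast]
  gcongr
  exact hC s

lemma abs_pow_mul_sub_taylor_le {C : ℝ} (hG : ∀ k < m, ∀ t, HasDerivAt (G k) (G (k + 1) t) t)
    (hC : ∀ t, |G m t| ≤ C) (a : ℕ) (c x : ℝ) :
    |x ^ a * G 0 (c * x)
        - ∑ k ∈ Finset.range m, G k 0 * c ^ k / (k.factorial : ℝ) * x ^ (k + a)|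
      ≤ |c| ^ m * C / (m.factorial : ℝ) * |x| ^ (m + a) := by
  have hfactor : x ^ a * G 0 (c * x)
        - ∑ k ∈ Finset.range m, G k 0 * c ^ k / (k.factorial : ℝ) * x ^ (k + a)
      = x ^ a * (G 0 (c * x)
        - ∑ k ∈ Finset.range m, G k 0 * (c * x) ^ k / (k.factorial : ℝ)) := by
    rw [mul_sub, Finset.mul_sum]
    congr 1
    exact Finset.sum_congr rfl fun k _ => by ring
  rw [hfactor, abs_mul, abs_pow]
  refine (mul_le_mul_of_nonneg_left (abs_sub_taylor_le hG hC _) (by positivity)).trans_eq ?_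
  rw [abs_mul]
  ring

end Taylor

section BoundedLineDerivatives

lemma integrable_comp_of_bounded {Ω S : Type*} [MeasurableSpace Ω] [MeasurableSpace S]
    {P : Measure Ω} [IsFiniteMeasure P] {g : S → ℝ} (hg : Measurable g)
    (hbdd : ∃ C, ∀ w, |g w| ≤ C) {Y : Ω → S} (hY : Measurable Y) :
    Integrable (fun ω => g (Y ω)) P := by
  obtain ⟨C, hC⟩ := hbdd
  exact .of_bound (hg.comp hY).aestronglyMeasurable C (.of_forall fun _ => hC _)

lemma integrable_mul_comp_of_bounded {Ω S : Type*} [MeasurableSpace Ω] [MeasurableSpace S]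
    {P : Measure Ω} {X : Ω → ℝ} (hX : Integrable X P) {g : S → ℝ} (hg : Measurable g)
    (hbdd : ∃ C, ∀ w, |g w| ≤ C) {Y : Ω → S} (hY : Measurable Y) :
    Integrable (fun ω => X ω * g (Y ω)) P := by
  obtain ⟨C, hC⟩ := hbdd
  exact hX.mul_bdd (c := C) (hg.comp hY).aestronglyMeasurable (.of_forall fun _ => hC _)

variable {E : Type*} [NormedAddCommGroup E] [NormedSpace ℝ E] {e : E} {g g' : E → ℝ}

lemma hasDerivAt_add_smul (hg : ∀ w, HasLineDerivAt ℝ g (g' w) w e) (y : E) (t : ℝ) :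
    HasDerivAt (fun t : ℝ => g (y + t • e)) (g' (y + t • e)) t := by
  have h : HasDerivAt (fun s : ℝ => g (y + t • e + s • e)) (g' (y + t • e)) (t - t) := by
    rw [sub_self]
    exact hg (y + t • e)
  refine (h.comp_sub_const t t).congr_of_eventuallyEq (.of_forall fun s => ?_)
  simp only [add_assoc, ← add_smul, add_sub_cancel]

lemma hasLineDerivAt_comp_smul_add (hg : ∀ w, HasLineDerivAt ℝ g (g' w) w e) (s : ℝ) (y w : E) :
    HasLineDerivAt ℝ (fun w => g (s • w + y)) (s * g' (s • w + y)) w e := by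
  have h := (hasDerivAt_add_smul hg (s • w + y) (s * 0)).comp 0
    ((hasDerivAt_id (0 : ℝ)).const_mul s)
  simp only [mul_zero, zero_smul, add_zero, mul_one] at h
  refine (h.congr_of_eventuallyEq (.of_forall fun t => ?_)).congr_deriv (mul_comm _ _)
  simp only [Function.comp_apply, smul_add, mul_smul, add_right_comm]

/-- `g` and `g'` are bounded measurable functions and `g'` is the derivative of `g` in the
direction `e`. -/
structure HasBddLineDeriv [MeasurableSpace E] (e : E) (g g' : E → ℝ) : Prop where
  measurable : Measurable g
  measurable' : Measurable g'
  bounded : ∃ C, ∀ w, |g w| ≤ C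
  bounded' : ∃ C, ∀ w, |g' w| ≤ C
  hasLineDerivAt : ∀ w, HasLineDerivAt ℝ g (g' w) w e

lemma hasBddLineDeriv_integral [MeasurableSpace E] {Ω : Type*} [MeasurableSpace Ω] {μ : Measure Ω}
    [IsFiniteMeasure μ] {F F' : E → Ω → ℝ} (hF : Measurable (Function.uncurry F))
    (hF' : Measurable (Function.uncurry F')) {C C' : ℝ} (hC : ∀ w ω, |F w ω| ≤ C)
    (hC' : ∀ w ω, |F' w ω| ≤ C') (hd : ∀ ω w, HasLineDerivAt ℝ (fun w => F w ω) (F' w ω) w e) :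
    HasBddLineDeriv e (fun w => ∫ ω, F w ω ∂μ) (fun w => ∫ ω, F' w ω ∂μ) where
  measurable := hF.stronglyMeasurable.integral_prod_right.measurable
  measurable' := hF'.stronglyMeasurable.integral_prod_right.measurable
  bounded := ⟨C * μ.real Set.univ, fun w =>
    (Real.norm_eq_abs _).symm.le.trans (norm_integral_le_of_norm_le_const (.of_forall (hC w)))⟩
  bounded' := ⟨C' * μ.real Set.univ, fun w =>
    (Real.norm_eq_abs _).symm.le.trans (norm_integral_le_of_norm_le_const (.of_forall (hC' w)))⟩
  hasLineDerivAt w := by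
    have hmeas {G : E → Ω → ℝ} (hG : Measurable (Function.uncurry G)) (w : E) :
        AEStronglyMeasurable (G w) μ := (hG.comp measurable_prodMk_left).aestronglyMeasurable
    have h := (hasDerivAt_integral_of_dominated_loc_of_deriv_le (x₀ := (0 : ℝ))
      (F := fun t ω => F (w + t • e) ω) (F' := fun t ω => F' (w + t • e) ω)
      (bound := fun _ => C') (s := Set.univ) (μ := μ) Filter.univ_mem
      (.of_forall fun t => hmeas hF _) (.of_bound (hmeas hF _) C (.of_forall fun ω => hC _ ω))
      (hmeas hF' _) (.of_forall fun ω t _ => hC' _ ω) (integrable_const _)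
      (.of_forall fun ω t _ => hasDerivAt_add_smul (hd ω) w t)).2
    simpa only [HasLineDerivAt, zero_smul, add_zero] using h

end BoundedLineDerivatives

section Independence

variable {Ω : Type*} [MeasurableSpace Ω] {P : Measure Ω}

lemma integral_eq_integral_integral_of_indepFun [IsFiniteMeasure P] {S T : Type*}
    [MeasurableSpace S] [MeasurableSpace T] {Y : Ω → S} {X : Ω → T} (hYX : IndepFun Y X P)
    (hY : Measurable Y) (hX : Measurable X) {F : S → T → ℝ} (hF : Measurable (Function.uncurry F))
    (hint : Integrable (fun ω => F (Y ω) (X ω)) P) :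
    ∫ ω, F (Y ω) (X ω) ∂P = ∫ ω, ∫ ω', F (Y ω) (X ω') ∂P ∂P := by
  have hlaw := (indepFun_iff_map_prod_eq_prod_map_map hY.aemeasurable hX.aemeasurable).1 hYX
  have hint' : Integrable (Function.uncurry F) ((P.map Y).prod (P.map X)) := by
    rw [← hlaw]
    exact (integrable_map_measure hF.aestronglyMeasurable (hY.prodMk hX).aemeasurable).2 hint
  calc ∫ ω, F (Y ω) (X ω) ∂P
      = ∫ z, Function.uncurry F z ∂(P.map fun ω => (Y ω, X ω)) :=
        (integral_map (hY.prodMk hX).aemeasurable hF.aestronglyMeasurable).symm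
    _ = ∫ y, ∫ x, F y x ∂(P.map X) ∂(P.map Y) := by
        rw [hlaw, integral_prod _ hint']
        rfl
    _ = ∫ ω, ∫ x, F (Y ω) x ∂(P.map X) ∂P :=
        integral_map hY.aemeasurable hint'.1.integral_prod_right'
    _ = ∫ ω, ∫ ω', F (Y ω) (X ω') ∂P ∂P := by
        congr 1 with ω
        exact integral_map hX.aemeasurable (hF.comp measurable_prodMk_left).aestronglyMeasurable

variable {ι E : Type*} [Fintype ι] [DecidableEq ι] [NormedAddCommGroup E] [NormedSpace ℝ E]
  [MeasurableSpace E] [BorelSpace E] [SecondCountableTopology E] {X : ι → Ω → ℝ}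

lemma indepFun_sum_erase_smul (hX : iIndepFun X P) (hX_meas : ∀ i, Measurable (X i)) (v : ι → E)
    (a : ι) :
    IndepFun (fun ω => ∑ i ∈ Finset.univ.erase a, X i ω • v i) (X a) P := by
  have heval : Measurable fun x : ↥({a} : Finset ι) → ℝ => x ⟨a, Finset.mem_singleton_self a⟩ :=
    measurable_pi_apply _
  have hcomp := (hX.indepFun_finset (Finset.univ.erase a) {a} (by simp) hX_meas).comp
    (φ := fun x => ∑ i : ↥(Finset.univ.erase a), x i • v i) (by fun_prop) heval
  convert hcomp using 1
  · ext ω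
    exact (Finset.sum_coe_sort (Finset.univ.erase a) fun i => X i ω • v i).symm
  · rfl

end Independence

section GaussianIntegrationByParts

variable {ι : Type*} [Fintype ι]

lemma map_apply_stdGaussian (i : ι) :
    (stdGaussian (EuclideanSpace ℝ ι)).map (fun z => z i) = gaussianReal 0 1 := by
  classical
  rw [← multivariateGaussian_zero_one]
  simpa using (measurePreserving_eval_multivariateGaussian (μ := 0) .one (i := i)).map_eq

lemma iIndepFun_apply_stdGaussian :
    iIndepFun (fun i (z : EuclideanSpace ℝ ι) => z i) (stdGaussian (EuclideanSpace ℝ ι)) := by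
  rw [iIndepFun_iff_map_fun_eq_pi_map fun i => by fun_prop]
  simp_rw [map_apply_stdGaussian]
  rw [← map_pi_eq_stdGaussian, Measure.map_map (by fun_prop) (by fun_prop)]
  exact Measure.map_id

lemma integral_comp_apply_stdGaussian (i : ι) {f : ℝ → ℝ} (hf : Measurable f) :
    ∫ z, f (z i) ∂(stdGaussian (EuclideanSpace ℝ ι)) = ∫ x, f x ∂(gaussianReal 0 1) := by
  rw [← map_apply_stdGaussian i, integral_map (by fun_prop) hf.aestronglyMeasurable]

lemma integrable_apply_stdGaussian (i : ι) :
    Integrable (fun z => z i) (stdGaussian (EuclideanSpace ℝ ι)) :=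
  (EuclideanSpace.proj i : EuclideanSpace ℝ ι →L[ℝ] ℝ).integrable_comp IsGaussian.integrable_id

lemma integral_eq_integral_slice_stdGaussian [DecidableEq ι] (i : ι)
    {F : EuclideanSpace ℝ ι → ℝ → ℝ} (hF : Measurable (Function.uncurry F))
    (hint : Integrable
      (fun z => F (∑ k ∈ Finset.univ.erase i, z k • EuclideanSpace.single k 1) (z i))
      (stdGaussian (EuclideanSpace ℝ ι))) :
    ∫ z, F (∑ k ∈ Finset.univ.erase i, z k • EuclideanSpace.single k 1) (z i)
        ∂(stdGaussian (EuclideanSpace ℝ ι))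
      = ∫ z, ∫ x, F (∑ k ∈ Finset.univ.erase i, z k • EuclideanSpace.single k 1) x
        ∂(gaussianReal 0 1) ∂(stdGaussian (EuclideanSpace ℝ ι)) := by
  rw [integral_eq_integral_integral_of_indepFun (indepFun_sum_erase_smul
    iIndepFun_apply_stdGaussian (fun k => by fun_prop) (fun k => EuclideanSpace.single k 1) i)
    (by fun_prop) (by fun_prop) hF hint]
  congr 1 with z
  exact integral_comp_apply_stdGaussian i (hF.comp measurable_prodMk_left)

lemma sum_erase_single_add [DecidableEq ι] (i : ι) (z : EuclideanSpace ℝ ι) :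
    ∑ k ∈ Finset.univ.erase i, z k • EuclideanSpace.single k (1 : ℝ)
      + z i • EuclideanSpace.single i (1 : ℝ) = z := by
  rw [Finset.sum_erase_add _ _ (Finset.mem_univ i)]
  simpa using (EuclideanSpace.basisFun ι ℝ).sum_repr z

lemma HasBddLineDeriv.integral_apply_mul_stdGaussian [DecidableEq ι] {i : ι}
    {g g' : EuclideanSpace ℝ ι → ℝ}
    (hg : HasBddLineDeriv (EuclideanSpace.single i (1 : ℝ)) g g') :
    ∫ z, z i * g z ∂(stdGaussian (EuclideanSpace ℝ ι))
      = ∫ z, g' z ∂(stdGaussian (EuclideanSpace ℝ ι)) := by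
  have hline : Measurable fun p : EuclideanSpace ℝ ι × ℝ =>
      p.1 + p.2 • EuclideanSpace.single i (1 : ℝ) := by fun_prop
  have hline_right (y : EuclideanSpace ℝ ι) :
      Measurable fun x : ℝ => y + x • EuclideanSpace.single i (1 : ℝ) := by fun_prop
  have slice := integral_eq_integral_slice_stdGaussian i
    (F := fun y x => x * g (y + x • EuclideanSpace.single i 1))
    (measurable_snd.mul (hg.measurable.comp hline)) (by
      simp only [sum_erase_single_add]
      exact integrable_mul_comp_of_bounded (integrable_apply_stdGaussian i) hg.measurable
        hg.bounded measurable_id)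
  have slice' := integral_eq_integral_slice_stdGaussian i
    (F := fun y x => g' (y + x • EuclideanSpace.single i 1)) (hg.measurable'.comp hline) (by
      simp only [sum_erase_single_add]
      exact integrable_comp_of_bounded hg.measurable' hg.bounded' measurable_id)
  simp only [sum_erase_single_add] at slice slice'
  rw [slice, slice']
  congr 1 with z
  have parts := integral_sub_mul_gaussianReal (μ := 0) (v := 1)
    (hasDerivAt_add_smul hg.hasLineDerivAt
      (∑ k ∈ Finset.univ.erase i, z k • EuclideanSpace.single k 1))
    (integrable_comp_of_bounded hg.measurable hg.bounded (hline_right _))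
    (integrable_comp_of_bounded hg.measurable' hg.bounded' (hline_right _))
    (integrable_mul_comp_of_bounded (by simpa using integrable_pow_gaussianReal 1)
      hg.measurable hg.bounded (hline_right _))
  simpa only [sub_zero, NNReal.coe_one, one_mul] using parts

end GaussianIntegrationByParts

section Mehler

variable {E : Type*} [NormedAddCommGroup E] [InnerProductSpace ℝ E] [FiniteDimensional ℝ E]
  [MeasurableSpace E]

/-- The Mehler semigroup `w ↦ E g(sin θ w + cos θ Z)`, with `Z` a standard normal vector. The
parametrisation by an angle makes it run from `E g(Z)` at `θ = 0` to `g` at `θ = π / 2`. -/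
def mehler (θ : ℝ) (g : E → ℝ) (w : E) : ℝ :=
  ∫ z, g (Real.sin θ • w + Real.cos θ • z) ∂(stdGaussian E)

/-- The average of the Mehler semigroup against `cos θ (sin θ)^k` over `0 ≤ θ ≤ π / 2`. For
`g = ∂^(k+1) h / ∂w_j^(k+1)` it is the `k`-th derivative in `w_j` of the `j`-th component of the
solution of the Stein equation with test function `h`. -/
def steinIntegral (k : ℕ) (g : E → ℝ) (w : E) : ℝ :=
  ∫ θ in (0 : ℝ)..(Real.pi / 2), Real.cos θ * Real.sin θ ^ k * mehler θ g w

lemma mehler_zero (g : E → ℝ) (w : E) : mehler 0 g w = ∫ z, g z ∂(stdGaussian E) := by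
  simp [mehler]

variable [BorelSpace E] {e : E} {g g' : E → ℝ}

lemma mehler_pi_div_two (g : E → ℝ) (w : E) : mehler (Real.pi / 2) g w = g w := by
  simp [mehler]

lemma measurable_mehler (hg : Measurable g) : Measurable fun p : E × ℝ => mehler p.2 g p.1 := by
  have h : Measurable fun p : (E × ℝ) × E =>
      g (Real.sin p.1.2 • p.1.1 + Real.cos p.1.2 • p.2) := by fun_prop
  exact h.stronglyMeasurable.integral_prod_right'.measurable

lemma abs_mehler_le {C : ℝ} (hC : ∀ w, |g w| ≤ C) (θ : ℝ) (w : E) : |mehler θ g w| ≤ C := by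
  simpa [mehler] using norm_integral_le_of_norm_le_const (μ := stdGaussian E)
    (f := fun z => g (Real.sin θ • w + Real.cos θ • z)) (.of_forall fun z => hC _)

lemma hasBddLineDeriv_mehler (hg : HasBddLineDeriv e g g') (θ : ℝ) :
    HasBddLineDeriv e (mehler θ g) (fun w => Real.sin θ * mehler θ g' w) := by
  obtain ⟨C, hC⟩ := hg.bounded
  obtain ⟨C', hC'⟩ := hg.bounded'
  have hpath : Measurable fun p : E × E => Real.sin θ • p.1 + Real.cos θ • p.2 := by fun_prop
  simp only [funext fun w => (mehler.eq_def θ g w), mehler.eq_def θ g', ← integral_const_mul]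
  refine hasBddLineDeriv_integral (hg.measurable.comp hpath)
    ((hg.measurable'.comp hpath).const_mul _) (fun _ _ => hC _) (C' := |Real.sin θ| * C')
    (fun w z => ?_) (fun z => hasLineDerivAt_comp_smul_add hg.hasLineDerivAt _ _)
  rw [abs_mul]
  exact mul_le_mul_of_nonneg_left (hC' _) (abs_nonneg _)

lemma measurable_steinIntegrand (hg : Measurable g) (k : ℕ) :
    Measurable fun p : E × ℝ => Real.cos p.2 * Real.sin p.2 ^ k * mehler p.2 g p.1 := by
  have htrig : Measurable fun p : E × ℝ => Real.cos p.2 * Real.sin p.2 ^ k := by fun_prop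
  exact htrig.mul (measurable_mehler hg)

lemma abs_steinIntegrand_le {C : ℝ} (hC : ∀ w, |g w| ≤ C) (k : ℕ) (θ : ℝ) (w : E) :
    |Real.cos θ * Real.sin θ ^ k * mehler θ g w| ≤ C := by
  rw [abs_mul, abs_mul, abs_pow, ← one_mul C]
  exact mul_le_mul (mul_le_one₀ (Real.abs_cos_le_one θ) (by positivity)
    (pow_le_one₀ (abs_nonneg _) (Real.abs_sin_le_one θ))) (abs_mehler_le hC θ w) (abs_nonneg _)
    zero_le_one

lemma intervalIntegrable_steinIntegrand (hg : Measurable g) (hbdd : ∃ C, ∀ w, |g w| ≤ C) (k : ℕ)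
    (w : E) (a b : ℝ) :
    IntervalIntegrable (fun θ => Real.cos θ * Real.sin θ ^ k * mehler θ g w) volume a b := by
  obtain ⟨C, hC⟩ := hbdd
  exact (intervalIntegrable_const (c := C)).mono_fun'
    ((measurable_steinIntegrand hg k).comp measurable_prodMk_left).aestronglyMeasurable
    (.of_forall fun θ => abs_steinIntegrand_le hC k θ w)

lemma hasBddLineDeriv_steinIntegral (hg : HasBddLineDeriv e g g') (k : ℕ) :
    HasBddLineDeriv e (steinIntegral k g) (steinIntegral (k + 1) g') := by
  obtain ⟨C, hC⟩ := hg.bounded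
  obtain ⟨C', hC'⟩ := hg.bounded'
  have hpi : 0 ≤ Real.pi / 2 := by positivity
  simp only [funext fun w => steinIntegral.eq_def k g w,
    funext fun w => steinIntegral.eq_def (k + 1) g' w, intervalIntegral.integral_of_le hpi]
  refine hasBddLineDeriv_integral (measurable_steinIntegrand hg.measurable k)
    (measurable_steinIntegrand hg.measurable' (k + 1)) (fun w θ => abs_steinIntegrand_le hC k θ w)
    (fun w θ => abs_steinIntegrand_le hC' (k + 1) θ w) fun θ w => ?_
  exact (((hasBddLineDeriv_mehler hg θ).hasLineDerivAt w).const_mul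
    (Real.cos θ * Real.sin θ ^ k)).congr_deriv (by ring)

lemma abs_steinIntegral_le {C : ℝ} (hC : ∀ w, |g w| ≤ C) (k : ℕ) (w : E) :
    |steinIntegral k g w| ≤ 1 / ((k : ℝ) + 1) * C := by
  rw [← Real.norm_eq_abs, ← integral_cos_mul_sin_pow, ← intervalIntegral.integral_mul_const]
  have hcont : Continuous fun θ => Real.cos θ * Real.sin θ ^ k * C := by fun_prop
  refine intervalIntegral.norm_integral_le_of_norm_le Real.pi_div_two_pos.le
    (.of_forall fun θ hθ => ?_) (hcont.intervalIntegrable (μ := volume) _ _)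
  have hcos : 0 ≤ Real.cos θ := Real.cos_nonneg_of_mem_Icc ⟨by linarith [hθ.1, Real.pi_pos], hθ.2⟩
  have hsin : 0 ≤ Real.sin θ :=
    Real.sin_nonneg_of_nonneg_of_le_pi hθ.1.le (by linarith [hθ.2, Real.pi_pos])
  rw [Real.norm_eq_abs, abs_mul, abs_of_nonneg (by positivity)]
  exact mul_le_mul_of_nonneg_left (abs_mehler_le hC θ w) (by positivity)

end Mehler

section MehlerIntegrationByParts

variable {ι : Type*} [Fintype ι] [DecidableEq ι] {g g' : EuclideanSpace ℝ ι → ℝ} {i : ι}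

lemma integral_apply_mul_comp_sin_smul_add_cos_smul
    (hg : HasBddLineDeriv (EuclideanSpace.single i (1 : ℝ)) g g') (θ : ℝ) (w : EuclideanSpace ℝ ι) :
    ∫ z, z i * g (Real.sin θ • w + Real.cos θ • z) ∂(stdGaussian (EuclideanSpace ℝ ι))
      = Real.cos θ * mehler θ g' w := by
  have hpath : Measurable fun z : EuclideanSpace ℝ ι => Real.cos θ • z + Real.sin θ • w := by
    fun_prop
  obtain ⟨C, hC⟩ := hg.bounded
  obtain ⟨C', hC'⟩ := hg.bounded'
  have hcomp : HasBddLineDeriv (EuclideanSpace.single i (1 : ℝ))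
      (fun z => g (Real.cos θ • z + Real.sin θ • w))
      (fun z => Real.cos θ * g' (Real.cos θ • z + Real.sin θ • w)) :=
    { measurable := hg.measurable.comp hpath
      measurable' := (hg.measurable'.comp hpath).const_mul _
      bounded := ⟨C, fun _ => hC _⟩
      bounded' := ⟨|Real.cos θ| * C', fun z => by
        rw [abs_mul]
        exact mul_le_mul_of_nonneg_left (hC' _) (abs_nonneg _)⟩
      hasLineDerivAt := hasLineDerivAt_comp_smul_add hg.hasLineDerivAt _ _ }
  simpa only [mehler, add_comm (Real.cos θ • (_ : EuclideanSpace ℝ ι)), integral_const_mul] using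
    hcomp.integral_apply_mul_stdGaussian

lemma abs_cos_mul_mehler_le (hg : HasBddLineDeriv (EuclideanSpace.single i (1 : ℝ)) g g') {C : ℝ}
    (hC : ∀ w, |g w| ≤ C) (θ : ℝ) (w : EuclideanSpace ℝ ι) :
    |Real.cos θ * mehler θ g' w| ≤ √(2 / Real.pi) * C := by
  have habs := integral_abs_gaussianReal (v := 1)
  rw [NNReal.coe_one, mul_one, ← integral_comp_apply_stdGaussian i (by fun_prop)] at habs
  rw [← Real.norm_eq_abs, ← integral_apply_mul_comp_sin_smul_add_cos_smul hg, ← habs,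
    ← integral_mul_const]
  refine norm_integral_le_of_norm_le ((integrable_apply_stdGaussian i).abs.mul_const C)
    (.of_forall fun z => ?_)
  rw [Real.norm_eq_abs, abs_mul]
  exact mul_le_mul_of_nonneg_left (hC _) (abs_nonneg _)

lemma abs_steinIntegral_le_of_hasBddLineDeriv
    (hg : HasBddLineDeriv (EuclideanSpace.single i (1 : ℝ)) g g') {C : ℝ} (hC : ∀ w, |g w| ≤ C)
    (k : ℕ) (w : EuclideanSpace ℝ ι) :
    |steinIntegral k g' w|
      ≤ Real.Gamma (((k : ℝ) + 1) / 2) / (√2 * Real.Gamma ((k : ℝ) / 2 + 1)) * C := by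
  rw [← Real.norm_eq_abs, ← sqrt_two_div_pi_mul_integral_sin_pow, mul_right_comm,
    ← intervalIntegral.integral_const_mul]
  have hcont : Continuous fun θ => √(2 / Real.pi) * C * Real.sin θ ^ k := by fun_prop
  refine intervalIntegral.norm_integral_le_of_norm_le Real.pi_div_two_pos.le
    (.of_forall fun θ hθ => ?_) (hcont.intervalIntegrable (μ := volume) _ _)
  have hsin : 0 ≤ Real.sin θ :=
    Real.sin_nonneg_of_nonneg_of_le_pi hθ.1.le (by linarith [hθ.2, Real.pi_pos])
  rw [Real.norm_eq_abs, mul_right_comm, abs_mul, abs_of_nonneg (pow_nonneg hsin k)]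
  exact mul_le_mul_of_nonneg_right (abs_cos_mul_mehler_le hg hC θ w) (by positivity)

end MehlerIntegrationByParts

section SteinEquation

variable {ι : Type*} [Fintype ι] [DecidableEq ι] {h : EuclideanSpace ℝ ι → ℝ}
  {D D₂ : ι → EuclideanSpace ℝ ι → ℝ}

lemma apply_eq_sum_of_hasLineDerivAt {f' : EuclideanSpace ℝ ι →L[ℝ] ℝ} {D : ι → ℝ}
    {w : EuclideanSpace ℝ ι} (hf : HasFDerivAt h f' w)
    (hD : ∀ j, HasLineDerivAt ℝ h (D j) w (EuclideanSpace.single j 1))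
    (v : EuclideanSpace ℝ ι) : f' v = ∑ j, v j * D j := by
  have hv : ∑ j, v j • EuclideanSpace.single j (1 : ℝ) = v := by
    simpa using (EuclideanSpace.basisFun ι ℝ).sum_repr v
  calc f' v = ∑ j, v j * f' (EuclideanSpace.single j 1) := by
        conv_lhs => rw [← hv, map_sum]
        simp only [map_smul, smul_eq_mul]
    _ = ∑ j, v j * D j := by simp only [(hf.hasLineDerivAt _).unique (hD _)]

lemma hasDerivAt_comp_sin_smul_add_cos_smul (hh : Differentiable ℝ h)
    (hD : ∀ j w, HasLineDerivAt ℝ h (D j w) w (EuclideanSpace.single j 1))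
    (w z : EuclideanSpace ℝ ι) (θ : ℝ) :
    HasDerivAt (fun θ => h (Real.sin θ • w + Real.cos θ • z))
      (∑ j, (Real.cos θ * w j - Real.sin θ * z j) * D j (Real.sin θ • w + Real.cos θ • z)) θ := by
  have hpath := ((Real.hasDerivAt_sin θ).smul_const w).add ((Real.hasDerivAt_cos θ).smul_const z)
  refine ((hh _).hasFDerivAt.comp_hasDerivAt θ hpath).congr_deriv ?_
  rw [apply_eq_sum_of_hasLineDerivAt (hh _).hasFDerivAt fun j => hD j _]
  simp [sub_eq_add_neg]

lemma hasDerivAt_mehler_integral (hh : Differentiable ℝ h) (hbdd : ∃ C, ∀ w, |h w| ≤ C)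
    (hD : ∀ j, HasBddLineDeriv (EuclideanSpace.single j 1) h (D j)) (w : EuclideanSpace ℝ ι)
    (θ : ℝ) :
    HasDerivAt (fun θ => mehler θ h w)
      (∫ z, ∑ j, (Real.cos θ * w j - Real.sin θ * z j)
        * D j (Real.sin θ • w + Real.cos θ • z) ∂(stdGaussian (EuclideanSpace ℝ ι))) θ := by
  choose C hC using fun j => (hD j).bounded'
  have hpath (θ : ℝ) :
      Measurable fun z : EuclideanSpace ℝ ι => Real.sin θ • w + Real.cos θ • z := by fun_prop
  have hD_meas := fun j => (hD j).measurable'.comp (hpath θ)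
  have hbound (z : EuclideanSpace ℝ ι) (θ : ℝ) :
      ‖∑ j, (Real.cos θ * w j - Real.sin θ * z j) * D j (Real.sin θ • w + Real.cos θ • z)‖
        ≤ ∑ j, (|w j| + |z j|) * C j := by
    refine (norm_sum_le _ _).trans (Finset.sum_le_sum fun j _ => ?_)
    rw [Real.norm_eq_abs, abs_mul]
    refine mul_le_mul ((abs_sub _ _).trans (add_le_add ?_ ?_)) (hC j _) (abs_nonneg _)
      (by positivity)
    · rw [abs_mul]
      exact mul_le_of_le_one_left (abs_nonneg _) (Real.abs_cos_le_one θ)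
    · rw [abs_mul]
      exact mul_le_of_le_one_left (abs_nonneg _) (Real.abs_sin_le_one θ)
  have hbound_int : Integrable (fun z : EuclideanSpace ℝ ι => ∑ j, (|w j| + |z j|) * C j)
      (stdGaussian (EuclideanSpace ℝ ι)) :=
    integrable_finsetSum _ fun j _ =>
      ((integrable_const _).add (integrable_apply_stdGaussian j).abs).mul_const _
  exact (hasDerivAt_integral_of_dominated_loc_of_deriv_le (s := Set.univ)
    (F := fun θ z => h (Real.sin θ • w + Real.cos θ • z)) Filter.univ_mem
    (.of_forall fun θ => (hh.continuous.measurable.comp (hpath θ)).aestronglyMeasurable)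
    (integrable_comp_of_bounded hh.continuous.measurable hbdd (hpath θ))
    (Finset.measurable_fun_sum _ fun j _ =>
      Measurable.mul (by fun_prop) (hD_meas j)).aestronglyMeasurable
    (.of_forall fun z θ _ => hbound z θ) hbound_int
    (.of_forall fun z θ _ => hasDerivAt_comp_sin_smul_add_cos_smul hh
      (fun j => (hD j).hasLineDerivAt) w z θ)).2

lemma hasDerivAt_mehler (hh : Differentiable ℝ h) (hbdd : ∃ C, ∀ w, |h w| ≤ C)
    (hD : ∀ j, HasBddLineDeriv (EuclideanSpace.single j 1) h (D j))
    (hD₂ : ∀ j, HasBddLineDeriv (EuclideanSpace.single j 1) (D j) (D₂ j))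
    (w : EuclideanSpace ℝ ι) (θ : ℝ) :
    HasDerivAt (fun θ => mehler θ h w)
      (∑ j, (w j * (Real.cos θ * Real.sin θ ^ 0 * mehler θ (D j) w)
        - Real.cos θ * Real.sin θ ^ 1 * mehler θ (D₂ j) w)) θ := by
  refine (hasDerivAt_mehler_integral hh hbdd hD w θ).congr_deriv ?_
  have hpath : Measurable fun z : EuclideanSpace ℝ ι => Real.sin θ • w + Real.cos θ • z := by
    fun_prop
  have hint (j : ι) := integrable_comp_of_bounded (P := stdGaussian (EuclideanSpace ℝ ι))
    (hD₂ j).measurable (hD₂ j).bounded hpath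
  have hint' (j : ι) := integrable_mul_comp_of_bounded (integrable_apply_stdGaussian j)
    (hD₂ j).measurable (hD₂ j).bounded hpath
  simp only [sub_mul, mul_assoc]
  rw [integral_finsetSum _ fun j _ =>
    (((hint j).const_mul _).const_mul _).sub' ((hint' j).const_mul _)]
  refine Finset.sum_congr rfl fun j _ => ?_
  rw [integral_sub (((hint j).const_mul _).const_mul _) ((hint' j).const_mul _),
    integral_const_mul, integral_const_mul, integral_const_mul,
    integral_apply_mul_comp_sin_smul_add_cos_smul (hD₂ j)]
  simp only [mehler]
  ring

theorem stein_equation (hh : Differentiable ℝ h) (hbdd : ∃ C, ∀ w, |h w| ≤ C)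
    (hD : ∀ j, HasBddLineDeriv (EuclideanSpace.single j 1) h (D j))
    (hD₂ : ∀ j, HasBddLineDeriv (EuclideanSpace.single j 1) (D j) (D₂ j))
    (w : EuclideanSpace ℝ ι) :
    h w - ∫ z, h z ∂(stdGaussian (EuclideanSpace ℝ ι))
      = ∑ j, (w j * steinIntegral 0 (D j) w - steinIntegral 1 (D₂ j) w) := by
  have hint (j : ι) := (intervalIntegrable_steinIntegrand (hD₂ j).measurable (hD₂ j).bounded 0 w
    0 (Real.pi / 2)).const_mul (w j)
  have hint' (j : ι) := intervalIntegrable_steinIntegrand (hD₂ j).measurable' (hD₂ j).bounded' 1 w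
    0 (Real.pi / 2)
  have hftc := intervalIntegral.integral_eq_sub_of_hasDerivAt
    (fun θ _ => hasDerivAt_mehler hh hbdd hD hD₂ w θ)
    (by
      simpa only [Finset.sum_fn] using
        IntervalIntegrable.sum Finset.univ fun j _ => (hint j).sub (hint' j))
  rw [mehler_zero, mehler_pi_div_two] at hftc
  rw [← hftc, intervalIntegral.integral_finsetSum fun j _ => (hint j).sub (hint' j)]
  refine Finset.sum_congr rfl fun j _ => ?_
  rw [intervalIntegral.integral_sub (hint j) (hint' j), intervalIntegral.integral_const_mul]
  rfl

end SteinEquation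

section Cb

variable {d m : ℕ} {h : EuclideanSpace ℝ (Fin d) → ℝ}

lemma iterPartialDeriv_succ (j : Fin d) (k : ℕ) (g : EuclideanSpace ℝ (Fin d) → ℝ) :
    iterPartialDeriv j (k + 1) g = partialDeriv j (iterPartialDeriv j k g) :=
  Function.iterate_succ_apply' _ _ _

lemma IsCb.hasFDerivAt_iteratedFDeriv_apply (hh : IsCb m h) {k : ℕ} (hk : k < m)
    (v : Fin k → EuclideanSpace ℝ (Fin d)) (w : EuclideanSpace ℝ (Fin d)) :
    HasFDerivAt (fun w => iteratedFDeriv ℝ k h w v)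
      ((fderiv ℝ (iteratedFDeriv ℝ k h) w).flipMultilinear v) w :=
  (hh.differentiable k hk w).hasFDerivAt.continuousMultilinear_apply_const v

lemma IsCb.hasLineDerivAt_iteratedFDeriv_apply (hh : IsCb m h) {k : ℕ} (hk : k < m)
    (e w : EuclideanSpace ℝ (Fin d)) :
    HasLineDerivAt ℝ (fun w => iteratedFDeriv ℝ k h w fun _ => e)
      (iteratedFDeriv ℝ (k + 1) h w fun _ => e) w e :=
  (hh.hasFDerivAt_iteratedFDeriv_apply hk _ w).hasLineDerivAt e

lemma IsCb.iterPartialDeriv_eq (hh : IsCb m h) (j : Fin d) {k : ℕ} (hk : k ≤ m) :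
    iterPartialDeriv j k h
      = fun w => iteratedFDeriv ℝ k h w (fun _ => EuclideanSpace.single j (1 : ℝ)) := by
  induction k with
  | zero => ext w; simp [iterPartialDeriv]
  | succ k ih =>
    ext w
    rw [iterPartialDeriv_succ, ih (by omega), partialDeriv,
      (hh.hasLineDerivAt_iteratedFDeriv_apply (by omega) _ w).lineDeriv]

lemma IsCb.bddAbove_abs_iterPartialDeriv (hh : IsCb m h) (j : Fin d) {k : ℕ} (hk : k ≤ m) :
    BddAbove (Set.range fun w => |iterPartialDeriv j k h w|) := by
  obtain ⟨C, hC⟩ := hh.bounded k hk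
  refine ⟨C, ?_⟩
  rintro _ ⟨w, rfl⟩
  simp only [hh.iterPartialDeriv_eq j hk]
  refine ((iteratedFDeriv ℝ k h w).le_opNorm _).trans ?_
  simpa using hC w

lemma IsCb.abs_iterPartialDeriv_le (hh : IsCb m h) (j : Fin d) {k : ℕ} (hk : k ≤ m)
    (w : EuclideanSpace ℝ (Fin d)) :
    |iterPartialDeriv j k h w| ≤ supNorm (iterPartialDeriv j k h) :=
  le_ciSup (hh.bddAbove_abs_iterPartialDeriv j hk) w

lemma IsCb.continuous_iterPartialDeriv (hh : IsCb m h) (j : Fin d) {k : ℕ} (hk : k < m) :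
    Continuous (iterPartialDeriv j k h) := by
  rw [hh.iterPartialDeriv_eq j hk.le]
  exact continuous_iff_continuousAt.2 fun w =>
    (hh.hasFDerivAt_iteratedFDeriv_apply hk _ w).continuousAt

lemma IsCb.hasBddLineDeriv (hh : IsCb m h) (j : Fin d) {k : ℕ} (hk : k < m) :
    HasBddLineDeriv (EuclideanSpace.single j (1 : ℝ)) (iterPartialDeriv j k h)
      (iterPartialDeriv j (k + 1) h) where
  measurable := (hh.continuous_iterPartialDeriv j hk).measurable
  measurable' := by
    rw [iterPartialDeriv_succ]
    exact measurable_lineDeriv (hh.continuous_iterPartialDeriv j hk)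
  bounded := ⟨_, hh.abs_iterPartialDeriv_le j hk.le⟩
  bounded' := ⟨_, hh.abs_iterPartialDeriv_le j hk⟩
  hasLineDerivAt w := by
    rw [hh.iterPartialDeriv_eq j hk.le, hh.iterPartialDeriv_eq j hk]
    exact hh.hasLineDerivAt_iteratedFDeriv_apply hk _ w

lemma IsCb.differentiable_self (hh : IsCb m h) (hm : 0 < m) : Differentiable ℝ h := fun w => by
  simpa using (hh.hasFDerivAt_iteratedFDeriv_apply hm (fun _ => 0) w).differentiableAt

lemma IsCb.bounded_self (hh : IsCb m h) : ∃ C, ∀ w, |h w| ≤ C := by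
  simpa using hh.bounded 0 (Nat.zero_le m)

lemma IsCb.abs_steinIntegral_le_M (hh : IsCb m h) (j : Fin d) {k : ℕ} (hk : k < m)
    (w : EuclideanSpace ℝ (Fin d)) :
    |steinIntegral k (iterPartialDeriv j (k + 1) h) w| ≤ M h j k :=
  le_min
    (abs_steinIntegral_le_of_hasBddLineDeriv (hh.hasBddLineDeriv j hk)
      (hh.abs_iterPartialDeriv_le j hk.le) k w)
    (abs_steinIntegral_le (hh.abs_iterPartialDeriv_le j hk) k w)

lemma M_zero_le_supNorm_partialDeriv (h : EuclideanSpace ℝ (Fin d) → ℝ) (j : Fin d) :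
    M h j 0 ≤ supNorm (partialDeriv j h) :=
  (min_le_right _ _).trans_eq (by simp [iterPartialDeriv])

lemma IsCb.sub_integral_stdGaussian_eq (hh : IsCb m h) (hm : 2 ≤ m)
    (w : EuclideanSpace ℝ (Fin d)) :
    h w - ∫ z, h z ∂(stdGaussian (EuclideanSpace ℝ (Fin d)))
      = ∑ j, (w j * steinIntegral 0 (iterPartialDeriv j 1 h) w
          - steinIntegral 1 (iterPartialDeriv j 2 h) w) :=
  stein_equation (hh.differentiable_self (by omega)) hh.bounded_self
    (fun j => hh.hasBddLineDeriv j (k := 0) (by omega))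
    (fun j => hh.hasBddLineDeriv j (k := 1) (by omega)) w

end Cb

section MomentComparison

variable {Ω : Type*} [MeasurableSpace Ω] {P : Measure Ω} {X : Ω → ℝ}

lemma integrable_pow_of_integrable_abs_pow [IsFiniteMeasure P] (hX : Measurable X) {k l : ℕ}
    (hkl : k ≤ l) (hX_int : Integrable (fun ω => |X ω| ^ l) P) :
    Integrable (fun ω => X ω ^ k) P := by
  refine (integrable_norm_iff (by fun_prop)).1 ?_
  simpa only [norm_pow] using integrable_norm_pow_of_le hX.aestronglyMeasurable hkl hX_int

lemma abs_integral_pow_mul_comp_sub_le [IsFiniteMeasure P] (hX : Measurable X) {r a : ℕ}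
    (hX_int : Integrable (fun ω => |X ω| ^ (r + a)) P) {G : ℕ → ℝ → ℝ} {C : ℝ}
    (hG_meas : Measurable (G 0)) (hG : ∀ k < r, ∀ t, HasDerivAt (G k) (G (k + 1) t) t)
    (hC : ∀ t, |G r t| ≤ C) (c : ℝ) :
    |∫ ω, X ω ^ a * G 0 (c * X ω) ∂P
        - ∑ k ∈ Finset.range r, G k 0 * c ^ k / (k.factorial : ℝ) * ∫ ω, X ω ^ (k + a) ∂P|
      ≤ |c| ^ r * C * ((∫ ω, |X ω| ^ (r + a) ∂P) / (r.factorial : ℝ)) := by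
  set taylor : Ω → ℝ := fun ω =>
    ∑ k ∈ Finset.range r, G k 0 * c ^ k / (k.factorial : ℝ) * X ω ^ (k + a)
  have hpow_int {k : ℕ} (hk : k ∈ Finset.range r) :
      Integrable (fun ω => G k 0 * c ^ k / (k.factorial : ℝ) * X ω ^ (k + a)) P :=
    (integrable_pow_of_integrable_abs_pow hX (by have := Finset.mem_range.1 hk; omega)
      hX_int).const_mul _
  have htaylor_int : Integrable taylor P := integrable_finsetSum _ fun k hk => hpow_int hk
  have htaylor : ∑ k ∈ Finset.range r, G k 0 * c ^ k / (k.factorial : ℝ)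
      * ∫ ω, X ω ^ (k + a) ∂P = ∫ ω, taylor ω ∂P := by
    simp only [taylor, integral_finsetSum _ fun _ hk => hpow_int hk, integral_const_mul]
  have hbound (ω : Ω) : ‖X ω ^ a * G 0 (c * X ω) - taylor ω‖
      ≤ |c| ^ r * C / (r.factorial : ℝ) * |X ω| ^ (r + a) :=
    abs_pow_mul_sub_taylor_le hG hC a c (X ω)
  have hbound_int := hX_int.const_mul (|c| ^ r * C / (r.factorial : ℝ))
  have hsub_int : Integrable (fun ω => X ω ^ a * G 0 (c * X ω) - taylor ω) P :=
    hbound_int.mono' (by fun_prop) (.of_forall hbound)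
  have hint : Integrable (fun ω => X ω ^ a * G 0 (c * X ω)) P := by
    simpa only [Pi.add_def, sub_add_cancel] using hsub_int.add htaylor_int
  rw [htaylor, ← integral_sub hint htaylor_int, ← Real.norm_eq_abs]
  refine (norm_integral_le_of_norm_le hbound_int (.of_forall hbound)).trans_eq ?_
  rw [integral_const_mul]
  ring

lemma add_one_mul_momentMismatch_sub (P : Measure Ω) (X : Ω → ℝ) (k : ℕ) :
    ((k : ℝ) + 1) * momentMismatch P X k - momentMismatch P X (k + 2)
      = ((k : ℝ) + 1) * ∫ ω, X ω ^ k ∂P - ∫ ω, X ω ^ (k + 2) ∂P := by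
  rw [momentMismatch, momentMismatch, integral_pow_add_two_gaussianReal,
    NNReal.coe_one]
  ring

lemma momentMismatch_one (P : Measure Ω) (X : Ω → ℝ) : momentMismatch P X 1 = ∫ ω, X ω ∂P := by
  simp [momentMismatch]

lemma taylor_moments_sub_eq (P : Measure Ω) (X : Ω → ℝ) (γ : ℕ → ℝ) (c : ℝ) (q : ℕ) :
    c * ∑ k ∈ Finset.range (q + 1), γ k * c ^ k / (k.factorial : ℝ) * ∫ ω, X ω ^ (k + 1) ∂P
        - c ^ 2 * ∑ k ∈ Finset.range q, γ (k + 1) * c ^ k / (k.factorial : ℝ) * ∫ ω, X ω ^ k ∂P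
      = c * momentMismatch P X 1 * γ 0
        - ∑ k ∈ Finset.Icc 1 q, c ^ (k + 1) / (k.factorial : ℝ) * γ k
            * ((k : ℝ) * momentMismatch P X (k - 1) - momentMismatch P X (k + 1)) := by
  induction q with
  | zero =>
    simp only [zero_add, Finset.sum_range_one, momentMismatch_one, pow_zero, pow_one,
      Nat.factorial_zero, Nat.cast_one, Finset.sum_range_zero, Finset.Icc_eq_empty_of_lt one_pos,
      Finset.sum_empty]
    ring
  | succ q ih =>
    rw [Finset.sum_range_succ, Finset.sum_range_succ
        (fun k => γ (k + 1) * c ^ k / (k.factorial : ℝ) * ∫ ω, X ω ^ k ∂P) q,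
      Finset.sum_Icc_succ_top (by omega), add_tsub_cancel_right, Nat.cast_add_one,
      add_one_mul_momentMismatch_sub, Nat.factorial_succ, Nat.cast_mul, Nat.cast_add_one]
    have hfac : (q.factorial : ℝ) ≠ 0 := by positivity
    have hq : (q : ℝ) + 1 ≠ 0 := by positivity
    linear_combination (norm := (field_simp; ring)) ih

/-- The bound on `|E[c X f(c X) - c² f'(c X)]|` in terms of the moments of `X` for a function `f`
whose derivatives up to order `q + 1` satisfy `‖f^(k)‖ ≤ m k`. In the theorem `c = 1 / √n`,
`q = p - 1` and `f` is a restriction of a component of the solution of the Stein equation to a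
coordinate line. -/
def momentError (P : Measure Ω) (X : Ω → ℝ) (c : ℝ) (q : ℕ) (m : ℕ → ℝ) : ℝ :=
  c * |momentMismatch P X 1| * m 0
    + (∑ k ∈ Finset.Icc 1 q, c ^ (k + 1) / (k.factorial : ℝ) * m k
        * |(k : ℝ) * momentMismatch P X (k - 1) - momentMismatch P X (k + 1)|)
    + c ^ (q + 2) * m (q + 1) * ((∫ ω, |X ω| ^ q ∂P) / (q.factorial : ℝ)
        + (∫ ω, |X ω| ^ (q + 2) ∂P) / ((q + 1).factorial : ℝ))

lemma abs_taylor_moments_sub_le (P : Measure Ω) (X : Ω → ℝ) {γ m : ℕ → ℝ} {c : ℝ} (hc : 0 ≤ c)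
    {q : ℕ} (hγ : ∀ k ≤ q, |γ k| ≤ m k) :
    |c * ∑ k ∈ Finset.range (q + 1), γ k * c ^ k / (k.factorial : ℝ) * ∫ ω, X ω ^ (k + 1) ∂P
        - c ^ 2 * ∑ k ∈ Finset.range q, γ (k + 1) * c ^ k / (k.factorial : ℝ) * ∫ ω, X ω ^ k ∂P|
      ≤ c * |momentMismatch P X 1| * m 0
        + ∑ k ∈ Finset.Icc 1 q, c ^ (k + 1) / (k.factorial : ℝ) * m k
            * |(k : ℝ) * momentMismatch P X (k - 1) - momentMismatch P X (k + 1)| := by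
  rw [taylor_moments_sub_eq]
  refine (abs_sub _ _).trans (add_le_add ?_ ((Finset.abs_sum_le_sum_abs _ _).trans
    (Finset.sum_le_sum fun k hk => ?_)))
  · rw [abs_mul, abs_mul, abs_of_nonneg hc]
    exact mul_le_mul_of_nonneg_left (hγ 0 (Nat.zero_le q)) (by positivity)
  · rw [abs_mul, abs_mul, abs_of_nonneg (by positivity : 0 ≤ c ^ (k + 1) / (k.factorial : ℝ))]
    have := hγ k (Finset.mem_Icc.1 hk).2
    gcongr

lemma abs_mul_sub_mul_le {a b : ℝ} (ha : 0 ≤ a) (hb : 0 ≤ b) (x y x' y' : ℝ) :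
    |a * x - b * y| ≤ |a * x' - b * y'| + (a * |x - x'| + b * |y - y'|) := by
  calc |a * x - b * y| = |(a * x' - b * y') + (a * (x - x') - b * (y - y'))| := by ring_nf
    _ ≤ |a * x' - b * y'| + (|a * (x - x')| + |b * (y - y')|) :=
        (abs_add_le _ _).trans (add_le_add_right (abs_sub _ _) _)
    _ = |a * x' - b * y'| + (a * |x - x'| + b * |y - y'|) := by
        rw [abs_mul, abs_mul, abs_of_nonneg ha, abs_of_nonneg hb]

lemma abs_integral_mul_comp_sub_le_momentError [IsFiniteMeasure P] (hX : Measurable X) {q : ℕ}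
    (hX_int : Integrable (fun ω => |X ω| ^ (q + 2)) P) {G : ℕ → ℝ → ℝ} {m : ℕ → ℝ}
    (hG_meas : Measurable (G 1)) (hG : ∀ k < q + 1, ∀ t, HasDerivAt (G k) (G (k + 1) t) t)
    (hm : ∀ k ≤ q + 1, ∀ t, |G k t| ≤ m k) {c : ℝ} (hc : 0 ≤ c) :
    |c * ∫ ω, X ω * G 0 (c * X ω) ∂P - c ^ 2 * ∫ ω, G 1 (c * X ω) ∂P|
      ≤ momentError P X c q m := by
  have hG0_meas : Measurable (G 0) :=
    (continuous_iff_continuousAt.2 fun t => (hG 0 (by omega) t).continuousAt).measurable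
  have hmul := abs_integral_pow_mul_comp_sub_le (a := 1) hX hX_int hG0_meas hG (hm _ le_rfl) c
  have hcomp := abs_integral_pow_mul_comp_sub_le (G := fun k => G (k + 1)) (r := q) (a := 0) hX
    (by simpa using (integrable_pow_of_integrable_abs_pow hX (by omega : q ≤ q + 2) hX_int).norm)
    hG_meas (fun k hk => hG (k + 1) (by omega)) (hm _ le_rfl) c
  have htaylor := abs_taylor_moments_sub_le P X (γ := fun k => G k 0) hc
    fun k (hk : k ≤ q) => hm k (by omega) 0
  simp only [pow_one, pow_zero, one_mul, add_zero, zero_add, abs_of_nonneg hc, add_assoc,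
    Nat.reduceAdd] at hmul hcomp htaylor
  refine (abs_mul_sub_mul_le hc (sq_nonneg c) _ _ _ _).trans ((add_le_add htaylor
    (add_le_add (mul_le_mul_of_nonneg_left hmul hc)
      (mul_le_mul_of_nonneg_left hcomp (sq_nonneg c)))).trans_eq ?_)
  rw [momentError]
  ring

end MomentComparison

section Replacement

variable {Ω E : Type*} [MeasurableSpace Ω] {P : Measure Ω} [NormedAddCommGroup E]
  [NormedSpace ℝ E] [MeasurableSpace E] {e : E}

lemma integrable_mul_sub_of_hasBddLineDeriv [IsFiniteMeasure P] {g g' : E → ℝ}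
    (hg : HasBddLineDeriv e g g') {X : Ω → ℝ} (hX_int : Integrable X P) {W : Ω → E}
    (hW : Measurable W) (c : ℝ) :
    Integrable (fun ω => c * (X ω * g (W ω)) - c ^ 2 * g' (W ω)) P :=
  ((integrable_mul_comp_of_bounded hX_int hg.measurable hg.bounded hW).const_mul c).sub
    ((integrable_comp_of_bounded hg.measurable' hg.bounded' hW).const_mul _)

variable [BorelSpace E] [SecondCountableTopology E] {D : ℕ → E → ℝ}

lemma abs_integral_mul_sub_le_momentError [IsProbabilityMeasure P] {X : Ω → ℝ}
    (hX : Measurable X) {q : ℕ} (hX_int : Integrable (fun ω => |X ω| ^ (q + 2)) P)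
    {Y : Ω → E} (hY : Measurable Y) (hYX : IndepFun Y X P)
    (hD : ∀ k ≤ q, HasBddLineDeriv e (D k) (D (k + 1))) {m : ℕ → ℝ}
    (hm : ∀ k ≤ q + 1, ∀ w, |D k w| ≤ m k) {c : ℝ} (hc : 0 ≤ c) :
    |∫ ω, (c * (X ω * D 0 (Y ω + (c * X ω) • e)) - c ^ 2 * D 1 (Y ω + (c * X ω) • e)) ∂P|
      ≤ momentError P X c q m := by
  have hD₀ := hD 0 (Nat.zero_le q)
  have hX_int₁ : Integrable X P := by
    simpa using integrable_pow_of_integrable_abs_pow hX (by omega : 1 ≤ q + 2) hX_int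
  have hline : Measurable fun p : E × ℝ => p.1 + (c * p.2) • e := by fun_prop
  have hline_X (y : E) : Measurable fun ω => y + (c * X ω) • e := by fun_prop
  have hF : Measurable (Function.uncurry fun (y : E) (x : ℝ) =>
      c * (x * D 0 (y + (c * x) • e)) - c ^ 2 * D 1 (y + (c * x) • e)) :=
    ((measurable_snd.mul (hD₀.measurable.comp hline)).const_mul c).sub
      ((hD₀.measurable'.comp hline).const_mul _)
  rw [integral_eq_integral_integral_of_indepFun hYX hY hX hF
    (integrable_mul_sub_of_hasBddLineDeriv hD₀ hX_int₁ (by fun_prop) c), ← Real.norm_eq_abs]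
  refine (norm_integral_le_of_norm_le_const (C := momentError P X c q m)
    (.of_forall fun ω => ?_)).trans_eq (by simp)
  rw [Real.norm_eq_abs,
    integral_sub ((integrable_mul_comp_of_bounded hX_int₁ hD₀.measurable hD₀.bounded
      (hline_X _)).const_mul c)
    ((integrable_comp_of_bounded hD₀.measurable' hD₀.bounded' (hline_X _)).const_mul _),
    integral_const_mul, integral_const_mul]
  exact abs_integral_mul_comp_sub_le_momentError (G := fun k t => D k (Y ω + t • e)) hX hX_int
    (hD₀.measurable'.comp (by fun_prop))
    (fun k hk => hasDerivAt_add_smul (hD k (by omega)).hasLineDerivAt _) (fun k hk t => hm k hk _)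
    hc

end Replacement

section StandardisedSum

variable {Ω : Type*} {n d : ℕ} {X : Fin n → Fin d → Ω → ℝ}

lemma standardisedSum_eq_sum_smul (X : Fin n → Fin d → Ω → ℝ) (ω : Ω) :
    standardisedSum X ω = ∑ a : Fin n × Fin d,
      X a.1 a.2 ω • (1 / √n) • EuclideanSpace.single a.2 (1 : ℝ) := by
  ext l
  simp [standardisedSum, Fintype.sum_prod_type, Finset.mul_sum, mul_comm, Pi.single_apply]

lemma standardisedSum_apply (X : Fin n → Fin d → Ω → ℝ) (ω : Ω) (j : Fin d) :
    standardisedSum X ω j = ∑ i, 1 / √n * X i j ω := by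
  simp [standardisedSum, Finset.mul_sum]

variable {h : EuclideanSpace ℝ (Fin d) → ℝ}

lemma IsCb.comp_standardisedSum_sub_eq {m : ℕ} (hh : IsCb m h) (hm : 2 ≤ m) (hn : 0 < n)
    (X : Fin n → Fin d → Ω → ℝ) (ω : Ω) :
    h (standardisedSum X ω) - ∫ z, h z ∂(stdGaussian (EuclideanSpace ℝ (Fin d)))
      = ∑ i, ∑ j,
        (1 / √n * (X i j ω * steinIntegral 0 (iterPartialDeriv j 1 h) (standardisedSum X ω))
          - (1 / √n) ^ 2 * steinIntegral 1 (iterPartialDeriv j 2 h) (standardisedSum X ω)) := by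
  have hsq : (n : ℝ) * (1 / √n) ^ 2 = 1 := by
    have hn : (n : ℝ) ≠ 0 := by positivity
    rw [div_pow, Real.sq_sqrt (by positivity), one_pow, mul_one_div_cancel hn]
  rw [hh.sub_integral_stdGaussian_eq hm, Finset.sum_comm]
  refine Finset.sum_congr rfl fun j _ => ?_
  rw [Finset.sum_sub_distrib, Finset.sum_const, Finset.card_fin, nsmul_eq_mul, ← mul_assoc, hsq,
    one_mul, standardisedSum_apply, Finset.sum_mul]
  simp only [mul_assoc]

variable [MeasurableSpace Ω] {P : Measure Ω}

lemma measurable_standardisedSum (hX : ∀ i j, Measurable (X i j)) :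
    Measurable (standardisedSum X) := by
  simp only [funext (standardisedSum_eq_sum_smul X)]
  fun_prop

lemma exists_indepFun_standardisedSum_eq_add (hX : ∀ i j, Measurable (X i j))
    (hX_indep : iIndepFun (fun (a : Fin n × Fin d) => X a.1 a.2) P) (i : Fin n) (j : Fin d) :
    ∃ Y : Ω → EuclideanSpace ℝ (Fin d), Measurable Y ∧ IndepFun Y (X i j) P ∧
      ∀ ω, standardisedSum X ω = Y ω + (1 / √n * X i j ω) • EuclideanSpace.single j (1 : ℝ) := by
  refine ⟨_, ?_, indepFun_sum_erase_smul hX_indep (fun a => hX a.1 a.2)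
    (fun a => (1 / √n) • EuclideanSpace.single a.2 (1 : ℝ)) (i, j), fun ω => ?_⟩
  · fun_prop
  · rw [standardisedSum_eq_sum_smul, ← Finset.sum_erase_add _ _ (Finset.mem_univ (i, j)),
      mul_comm, mul_smul]

lemma IsCb.integral_comp_standardisedSum_sub_eq [IsProbabilityMeasure P] {m : ℕ} (hh : IsCb m h)
    (hm : 2 ≤ m) (hn : 0 < n) (hX : ∀ i j, Measurable (X i j))
    (hX_int : ∀ i j, Integrable (X i j) P) :
    ∫ ω, h (standardisedSum X ω) ∂P - ∫ z, h z ∂(stdGaussian (EuclideanSpace ℝ (Fin d)))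
      = ∑ i, ∑ j, ∫ ω,
        (1 / √n * (X i j ω * steinIntegral 0 (iterPartialDeriv j 1 h) (standardisedSum X ω))
          - (1 / √n) ^ 2 * steinIntegral 1 (iterPartialDeriv j 2 h) (standardisedSum X ω)) ∂P := by
  have hW := measurable_standardisedSum hX
  have hh_int : Integrable (fun ω => h (standardisedSum X ω)) P := integrable_comp_of_bounded
    (hh.differentiable_self (by omega)).continuous.measurable hh.bounded_self hW
  have hint (i j) := integrable_mul_sub_of_hasBddLineDeriv
    (hasBddLineDeriv_steinIntegral (hh.hasBddLineDeriv j (k := 1) hm) 0) (hX_int i j) hW (1 / √n)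
  calc _ = ∫ ω, (h (standardisedSum X ω)
          - ∫ z, h z ∂(stdGaussian (EuclideanSpace ℝ (Fin d)))) ∂P := by
        rw [integral_sub hh_int (integrable_const _), integral_const, probReal_univ, one_smul]
    _ = _ := by
        simp only [hh.comp_standardisedSum_sub_eq hm hn]
        rw [integral_finsetSum _ fun i _ => integrable_finsetSum _ fun j _ => hint i j]
        simp only [integral_finsetSum _ fun j _ => hint _ j]

theorem abs_integral_comp_standardisedSum_sub_le [IsProbabilityMeasure P] {q : ℕ} (hn : 0 < n)
    (hX : ∀ i j, Measurable (X i j))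
    (hX_indep : iIndepFun (fun (a : Fin n × Fin d) => X a.1 a.2) P)
    (hX_int : ∀ i j, Integrable (fun ω => |X i j ω| ^ (q + 2)) P) (hh : IsCb (q + 2) h) :
    |∫ ω, h (standardisedSum X ω) ∂P - ∫ z, h z ∂(stdGaussian (EuclideanSpace ℝ (Fin d)))|
      ≤ ∑ i, ∑ j, momentError P (X i j) (1 / √n) q (M h j) := by
  have hX_int₁ (i j) : Integrable (X i j) P := by
    simpa using integrable_pow_of_integrable_abs_pow (hX i j) (by omega : 1 ≤ q + 2) (hX_int i j)
  rw [hh.integral_comp_standardisedSum_sub_eq (by omega) hn hX hX_int₁]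
  refine (Finset.abs_sum_le_sum_abs _ _).trans (Finset.sum_le_sum fun i _ =>
    (Finset.abs_sum_le_sum_abs _ _).trans (Finset.sum_le_sum fun j _ => ?_))
  obtain ⟨Y, hY, hYX, hW_eq⟩ := exists_indepFun_standardisedSum_eq_add hX hX_indep i j
  simp only [hW_eq]
  exact abs_integral_mul_sub_le_momentError
    (D := fun k => steinIntegral k (iterPartialDeriv j (k + 1) h)) (hX i j) (hX_int i j) hY hYX
    (fun k hk => hasBddLineDeriv_steinIntegral (hh.hasBddLineDeriv j (k := k + 1) (by omega)) k)
    (fun k hk => hh.abs_steinIntegral_le_M j (by omega)) (by positivity)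

lemma one_div_sqrt_pow {x : ℝ} (hx : 0 ≤ x) (k : ℕ) :
    (1 / √x) ^ k = 1 / x ^ ((k : ℝ) / 2) := by
  rw [div_pow, one_pow, Real.sqrt_eq_rpow, ← Real.rpow_mul_natCast hx]
  ring_nf

lemma momentError_one_div_sqrt (P : Measure Ω) (X : Ω → ℝ) {x : ℝ} (hx : 0 ≤ x) (q : ℕ)
    (m : ℕ → ℝ) :
    momentError P X (1 / √x) q m
      = |momentMismatch P X 1| / √x * m 0
        + (∑ k ∈ Finset.Icc 1 q, m k / ((k.factorial : ℝ) * x ^ (((k : ℝ) + 1) / 2))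
            * |(k : ℝ) * momentMismatch P X (k - 1) - momentMismatch P X (k + 1)|)
        + m (q + 1) / x ^ (((q + 1 : ℕ) + 1 : ℝ) / 2)
            * ((∫ ω, |X ω| ^ q ∂P) / (q.factorial : ℝ)
                + (∫ ω, |X ω| ^ (q + 2) ∂P) / ((q + 1).factorial : ℝ)) := by
  have hpow (k : ℕ) : (1 / √x) ^ (k + 1) = 1 / x ^ (((k : ℝ) + 1) / 2) := by
    rw [one_div_sqrt_pow hx, Nat.cast_add_one]
  rw [momentError, hpow (q + 1), one_div_mul_eq_div, one_div_mul_eq_div]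
  congr 2
  refine Finset.sum_congr rfl fun k _ => ?_
  rw [hpow, div_div, mul_comm (x ^ _), one_div_mul_eq_div]

end StandardisedSum

end MatchingMoments

end

theorem mainTheorem6 {Ω : Type*} [MeasurableSpace Ω] (P : Measure Ω) [IsProbabilityMeasure P]
    (n d p : ℕ) (hn : 1 ≤ n) (hp : 1 ≤ p)
    (X : Fin n → Fin d → Ω → ℝ)
    (hX_meas : ∀ i j, Measurable (X i j))
    (hX_indep : iIndepFun (fun (ij : Fin n × Fin d) => X ij.1 ij.2) P)
    (hX_mom : ∀ i j, Integrable (fun ω => |X i j ω| ^ (p + 1)) P)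
    (h : EuclideanSpace ℝ (Fin d) → ℝ) (hh : MatchingMoments.IsCb (p + 1) h) :
    |(∫ ω, h (MatchingMoments.standardisedSum X ω) ∂P)
        - ∫ z, h z ∂(stdGaussian (EuclideanSpace ℝ (Fin d)))|
      ≤ (∑ i, ∑ j, |MatchingMoments.momentMismatch P (X i j) 1| / Real.sqrt n
            * MatchingMoments.supNorm (MatchingMoments.partialDeriv j h))
        + (∑ i, ∑ j, ∑ k ∈ Finset.Icc 1 (p - 1),
            MatchingMoments.M h j k / ((k.factorial : ℝ) * (n : ℝ) ^ (((k : ℝ) + 1) / 2))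
              * |(k : ℝ) * MatchingMoments.momentMismatch P (X i j) (k - 1)
                  - MatchingMoments.momentMismatch P (X i j) (k + 1)|)
        + ∑ i, ∑ j, MatchingMoments.M h j p / (n : ℝ) ^ (((p : ℝ) + 1) / 2)
            * ((∫ ω, |X i j ω| ^ (p - 1) ∂P) / ((p - 1).factorial : ℝ)
                + (∫ ω, |X i j ω| ^ (p + 1) ∂P) / (p.factorial : ℝ)) := by
  obtain ⟨q, rfl⟩ : ∃ q, p = q + 1 := ⟨p - 1, by omega⟩
  refine (MatchingMoments.abs_integral_comp_standardisedSum_sub_le hn hX_meas hX_indep hX_mom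
    hh).trans ?_
  simp only [← Finset.sum_add_distrib, Nat.add_sub_cancel]
  refine Finset.sum_le_sum fun i _ => Finset.sum_le_sum fun j _ => ?_
  rw [MatchingMoments.momentError_one_div_sqrt P (X i j) n.cast_nonneg]
  gcongr
  exact MatchingMoments.M_zero_le_supNorm_partialDeriv h j
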